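/- Let $d\ge 1$, let $\mathcal S=\{x\in[0,1]^d:\ \|x\|_1\le 1\}$ with $\|x\|_1=\sum_{i=1}^d|x_i|$, and let $\mathrm{Int}(\mathcal S)=\{x\in(0,1)^d:\ \|x\|_1<1\}$. Let $X_1,X_2,\dots$ be independent random vectors in $\mathbb R^d$ with common joint c.d.f. $F(x)=\mathbb P(X_1\le x)$ (componentwise order), and let $F_n(x)=\frac1n\sum_{i=1}^n \mathbf 1_{\{X_i\le x\}}$ be the empirical c.d.f. For $m,n\in\mathbb N$ and $x\in\mathcal S$ put $$F^\star_m(x)=\sum_{k} F(k/m)\,P_{k,m}(x),\qquad F^\star_{n,m}(x)=\sum_{k} F_n(k/m)\,P_{k,m}(x),$$ where both sums run over the $k\in\mathbb N_0^d$ with $\|k\|_1\le m$, and $$P_{k,m}(x)=\frac{m!}{(m-\|k\|_1)!\prod_{i=1}^d k_i!}\,(1-\|x\|_1)^{m-\|k\|_1}\prod_{i=1}^d x_i^{k_i}.$$ **Theorem (Asymptotic normality).** Assume that $F$ is twice continuously differentiable on $\mathcal S$, and let $x\in\mathrm{Int}(\mathcal S)$ be such that $0<F(x)<1$. Put $$\sigma^2(x)=F(x)(1-F(x)),\qquad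 B(x)=\frac12\sum_{i,j=1}^d\big(x_i\mathbf 1_{\{i=j\}}-x_ix_j\big)\frac{\partial^2F}{\partial x_i\partial x_j}(x).$$ Let $m=m(n)$ be any sequence of positive integers with $m(n)\to\infty$ as $n\to\infty$. Then, as $n\to\infty$, $$n^{1/2}\big(F^\star_{n,m}(x)-F^\star_m(x)\big)\ \longrightarrow\ \mathcal N\big(0,\sigma^2(x)\big)\quad\text{in distribution.}$$ Moreover, if $n^{1/2}m^{-1}\to0$, then $$n^{1/2}\big(F^\star_{n,m}(x)-F(x)\big)\ \longrightarrow\ \mathcal N\big(0,\sigma^2(x)\big)\quad\text{in distribution,}$$ and if $n^{1/2}m^{-1}\to\lambda$ for some constant $\lambda>0$, then $$n^{1/2}\big(F^\star_{n,m}(x)-F(x)\big)\ \longrightarrow\ \mathcal N\big(\lambda B(x),\sigma^2(x)\big)\quad\text{in distribution.}$$ -/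

import Mathlib

open MeasureTheory ProbabilityTheory Filter Topology

noncomputable section

/-- The `ℓ¹` norm on `ℝ^d`. -/
def l1Norm {d : ℕ} (x : Fin d → ℝ) : ℝ := ∑ i, |x i|

/-- The closed unit simplex `𝒮 ⊆ ℝ^d`. -/
def unitSimplex (d : ℕ) : Set (Fin d → ℝ) :=
  {x | (∀ i, x i ∈ Set.Icc (0 : ℝ) 1) ∧ l1Norm x ≤ 1}

/-- The interior of the unit simplex. -/
def unitSimplexInt (d : ℕ) : Set (Fin d → ℝ) :=
  {x | (∀ i, x i ∈ Set.Ioo (0 : ℝ) 1) ∧ l1Norm x < 1}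

/-- The multi-indices `ℕ₀^d ∩ m𝒮`, that is, those `k` with `k₁ + ⋯ + k_d ≤ m`. -/
def latticeSimplex (d m : ℕ) : Finset (Fin d → ℕ) :=
  (Fintype.piFinset fun _ => Finset.range (m + 1)).filter fun k => ∑ i, k i ≤ m

theorem mem_latticeSimplex {d m : ℕ} {k : Fin d → ℕ} :
    k ∈ latticeSimplex d m ↔ ∑ i, k i ≤ m := by
  simp only [latticeSimplex, Finset.mem_filter, Fintype.mem_piFinset, Finset.mem_range,
    and_iff_right_iff_imp]
  intro h i
  exact Nat.lt_succ_of_le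
    ((Finset.single_le_sum (fun j _ => Nat.zero_le (k j)) (Finset.mem_univ i)).trans h)

/-- The multinomial probability `P_{k,m}(x)`. -/
def multinomialWeight {d : ℕ} (m : ℕ) (k : Fin d → ℕ) (x : Fin d → ℝ) : ℝ :=
  (m.factorial : ℝ) / (((m - ∑ i, k i).factorial : ℝ) * ∏ i, ((k i).factorial : ℝ))
    * ((1 - l1Norm x) ^ (m - ∑ i, k i) * ∏ i, x i ^ k i)

/-- The Bernstein polynomial of order `m` on the simplex for the function `G`. -/
def bernsteinPoly {d : ℕ} (m : ℕ) (G : (Fin d → ℝ) → ℝ) (x : Fin d → ℝ) : ℝ :=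
  ∑ k ∈ latticeSimplex d m, G (fun i => (k i : ℝ) / (m : ℝ)) * multinomialWeight m k x

/-- The joint cumulative distribution function of a law `ν` on `ℝ^d`
(the order on `Fin d → ℝ` is componentwise). -/
def jointCDF {d : ℕ} (ν : Measure (Fin d → ℝ)) (x : Fin d → ℝ) : ℝ :=
  ν.real (Set.Iic x)

/-- The empirical cumulative distribution function of the first `n` terms of the sequence `s`. -/
def empiricalCDF {d : ℕ} (n : ℕ) (s : ℕ → Fin d → ℝ) (x : Fin d → ℝ) : ℝ :=
  (n : ℝ)⁻¹ * ∑ i ∈ Finset.range n, (Set.Iic x).indicator (fun _ => (1 : ℝ)) (s i)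

/-- The Bernstein estimator `F⋆_{n,m}(x)`: the Bernstein polynomial of the empirical c.d.f. -/
def bernsteinEstimator {d : ℕ} (n m : ℕ) (s : ℕ → Fin d → ℝ) (x : Fin d → ℝ) : ℝ :=
  bernsteinPoly m (empiricalCDF n s) x

/-- The `i`-th partial derivative of a function on the simplex (one-sided at boundary points). -/
def partialDerivSimplex {d : ℕ} (i : Fin d) (G : (Fin d → ℝ) → ℝ) (x : Fin d → ℝ) : ℝ :=
  fderivWithin ℝ G (unitSimplex d) x (Pi.single i 1)

/-- The bias coefficient
`B(x) = ½ ∑_{i,j} (x_i 1_{i = j} - x_i x_j) ∂²F/∂x_i∂x_j (x)`. -/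
def biasCoeff {d : ℕ} (F : (Fin d → ℝ) → ℝ) (x : Fin d → ℝ) : ℝ :=
  (1 / 2 : ℝ) * ∑ i, ∑ j, ((if i = j then x i else 0) - x i * x j)
    * partialDerivSimplex i (partialDerivSimplex j F) x

/-- The asymptotic variance `σ²(x) = F(x) (1 - F(x))`. -/
def sigmaSq {d : ℕ} (F : (Fin d → ℝ) → ℝ) (x : Fin d → ℝ) : ℝ :=
  F x * (1 - F x)

end

/-! The estimator is the average of the i.i.d. variables `bernsteinKernel m x (X i)`, and as `m`
grows the kernel approaches the indicator of `X i ≤ x`. Write `f` for kernel minus indicator. Since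
`|f| ≤ 1`, its variance is at most `E|f|`, which is bounded by the Bernstein polynomial at `x` of `y
↦ ν(Iic x ∆ Iic y)`. That function vanishes at `x` and is continuous there, so the bound tends to 0
(`variance_bernsteinKernel_sub_le`, `tendsto_bernsteinPoly_cdfSymmDiff`). By Chebyshev the
normalised sums of `f` vanish in probability, and Slutsky transfers the central limit theorem from
the empirical c.d.f. at `x` to the estimator, whatever the rate of `m`.

Centring at `F x` instead adds the deterministic bias `√n (B_m F - F)(x) = (√n / m) · m (B_m F -
F)(x)`, where `B_m` is the Bernstein operator. Voronovskaya's theorem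
(`tendsto_mul_bernsteinPoly_sub`) gives its limit: a second-order Taylor expansion integrated
against the multinomial weights, with second moments producing `biasCoeff` and fourth moments
controlling the remainder. -/

/-! ### Moments of the multinomial weights -/

theorem sum_multinomialWeight_mul_prod_pow {d : ℕ} (m : ℕ) (x t : Fin d → ℝ) :
    ∑ k ∈ latticeSimplex d m, multinomialWeight m k x * ∏ i, t i ^ k i
      = (1 - l1Norm x + ∑ i, x i * t i) ^ m := by
  have h := Finset.sum_pow_eq_sum_piAntidiag (Finset.univ : Finset (Option (Fin d)))
    (fun o => o.elim (1 - l1Norm x) fun i => x i * t i) m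
  simp only [Fintype.sum_option, Option.elim] at h
  rw [h]
  -- The index `none` carries the leftover exponent `m - ∑ k i`, turning the simplex of
  -- multi-indices into exponents of total degree `m` in `d + 1` variables.
  refine Finset.sum_nbij' (fun k o => o.elim (m - ∑ i, k i) k) (fun k i => k (some i)) ?_ ?_ ?_ ?_ ?_
  · intro k hk
    rw [mem_latticeSimplex] at hk
    simp [Fintype.sum_option, hk]
  · intro k hk
    rw [mem_latticeSimplex]
    simp only [Finset.mem_piAntidiag, Fintype.sum_option] at hk
    omega
  · intro k _
    rfl
  · intro k hk
    simp only [Finset.mem_piAntidiag, Fintype.sum_option] at hk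
    funext o
    cases o with
    | none => simp only [Option.elim]; omega
    | some i => rfl
  · intro k hk
    rw [mem_latticeSimplex] at hk
    have hs := Nat.multinomial_spec (Finset.univ : Finset (Option (Fin d)))
      (fun o => o.elim (m - ∑ i, k i) k)
    simp only [Fintype.sum_option, Fintype.prod_option, Option.elim] at hs
    rw [Nat.sub_add_cancel hk] at hs
    have hs' := congrArg (Nat.cast (R := ℝ)) hs
    push_cast at hs'
    have hne : ((m - ∑ i, k i).factorial : ℝ) * ∏ i, ((k i).factorial : ℝ) ≠ 0 := by
      have : ∏ i, ((k i).factorial : ℝ) ≠ 0 :=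
        Finset.prod_ne_zero_iff.2 fun i _ => by positivity
      have : ((m - ∑ i, k i).factorial : ℝ) ≠ 0 := by positivity
      positivity
    rw [multinomialWeight, ← hs', mul_div_cancel_left₀ _ hne, Fintype.prod_option]
    simp only [Option.elim, mul_pow, Finset.prod_mul_distrib]
    ring

/-- The point masses of the categorical law on `Option (Fin d)` attached to `x`. -/
def categoricalWeight {d : ℕ} (x : Fin d → ℝ) (o : Option (Fin d)) : ℝ :=
  o.elim (1 - l1Norm x) x

theorem l1Norm_eq_sum {d : ℕ} {x : Fin d → ℝ} (hx : x ∈ unitSimplex d) : l1Norm x = ∑ i, x i :=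
  Finset.sum_congr rfl fun i _ => abs_of_nonneg (hx.1 i).1

theorem categoricalWeight_nonneg {d : ℕ} {x : Fin d → ℝ} (hx : x ∈ unitSimplex d)
    (o : Option (Fin d)) : 0 ≤ categoricalWeight x o := by
  cases o with
  | none => simpa [categoricalWeight] using hx.2
  | some i => exact (hx.1 i).1

theorem sum_categoricalWeight {d : ℕ} {x : Fin d → ℝ} (hx : x ∈ unitSimplex d) :
    ∑ o, categoricalWeight x o = 1 := by
  simp [Fintype.sum_option, categoricalWeight, l1Norm_eq_sum hx]

/-- The values of the centred linear form `a` under the categorical law attached to `x`. -/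
def centeredForm {d : ℕ} (a x : Fin d → ℝ) (o : Option (Fin d)) : ℝ :=
  o.elim 0 a - ∑ i, a i * x i

theorem sum_categoricalWeight_mul_centeredForm {d : ℕ} {x : Fin d → ℝ} (hx : x ∈ unitSimplex d)
    (a : Fin d → ℝ) : ∑ o, categoricalWeight x o * centeredForm a x o = 0 := by
  simp only [centeredForm, mul_sub, Finset.sum_sub_distrib, ← Finset.sum_mul,
    sum_categoricalWeight hx]
  simp [Fintype.sum_option, categoricalWeight, mul_comm]

theorem sum_categoricalWeight_mul_centeredForm_sq {d : ℕ} {x : Fin d → ℝ}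
    (hx : x ∈ unitSimplex d) (a : Fin d → ℝ) :
    ∑ o, categoricalWeight x o * centeredForm a x o ^ 2
      = ∑ i, a i ^ 2 * x i - (∑ i, a i * x i) ^ 2 := by
  have h : ∀ o : Option (Fin d), categoricalWeight x o * centeredForm a x o ^ 2
      = categoricalWeight x o * (o.elim 0 a) ^ 2
        - 2 * (∑ i, a i * x i) * (categoricalWeight x o * o.elim 0 a)
        + categoricalWeight x o * (∑ i, a i * x i) ^ 2 := fun o => by
    simp only [centeredForm]; ring
  simp only [h, Finset.sum_add_distrib, Finset.sum_sub_distrib, ← Finset.mul_sum, ← Finset.sum_mul,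
    sum_categoricalWeight hx]
  simp only [Fintype.sum_option, categoricalWeight, Option.elim, mul_comm (x _)]
  ring

theorem multinomialWeight_nonneg {d m : ℕ} {x : Fin d → ℝ} (hx : x ∈ unitSimplex d)
    (k : Fin d → ℕ) : 0 ≤ multinomialWeight m k x := by
  have h1 : 0 ≤ 1 - l1Norm x := by linarith [hx.2]
  have h2 : ∀ i, 0 ≤ x i := fun i => (hx.1 i).1
  have : 0 ≤ ∏ i, x i ^ k i := Finset.prod_nonneg fun i _ => pow_nonneg (h2 i) _
  unfold multinomialWeight
  positivity

theorem sum_multinomialWeight {d : ℕ} (m : ℕ) {x : Fin d → ℝ} (hx : x ∈ unitSimplex d) :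
    ∑ k ∈ latticeSimplex d m, multinomialWeight m k x = 1 := by
  have h := sum_multinomialWeight_mul_prod_pow m x (fun _ => 1)
  simpa [l1Norm_eq_sum hx] using h

/-- A multinomial vector is a sum of `m` independent categorical ones, so its centred moment
generating function is an `m`-th power. Concretely, take `t i = exp (s * a i)` in the generating
polynomial. All moments below come from this identity. -/
theorem sum_multinomialWeight_mul_exp {d : ℕ} (m : ℕ) (x a : Fin d → ℝ) (s : ℝ) :
    ∑ k ∈ latticeSimplex d m,
        multinomialWeight m k x * Real.exp (s * ∑ i, a i * ((k i : ℝ) - m * x i))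
      = (∑ o, categoricalWeight x o * Real.exp (s * centeredForm a x o)) ^ m := by
  have h := sum_multinomialWeight_mul_prod_pow m x (fun i => Real.exp (s * a i))
  have h2 : ∑ o, categoricalWeight x o * Real.exp (s * centeredForm a x o)
      = (1 - l1Norm x + ∑ i, x i * Real.exp (s * a i)) * Real.exp (-(s * ∑ i, a i * x i)) := by
    simp only [Fintype.sum_option, categoricalWeight, centeredForm, Option.elim, add_mul,
      Finset.sum_mul, mul_assoc, ← Real.exp_add]
    congr 1
    · ring_nf
    · exact Finset.sum_congr rfl fun i _ => by ring_nf
  rw [h2, mul_pow, ← h, Finset.sum_mul, ← Real.exp_nat_mul]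
  refine Finset.sum_congr rfl fun k _ => ?_
  simp only [← Real.exp_nat_mul]
  rw [← Real.exp_sum, mul_assoc, ← Real.exp_add]
  congr 2
  rw [mul_neg, ← sub_eq_add_neg]
  simp only [mul_sub, Finset.sum_sub_distrib, Finset.mul_sum]
  congr 1 <;> exact Finset.sum_congr rfl fun i _ => by ring

theorem hasDerivAt_sum_mul_exp {ι : Type*} (u : Finset ι) (p b : ι → ℝ) (s : ℝ) :
    HasDerivAt (fun s => ∑ j ∈ u, p j * Real.exp (s * b j))
      (∑ j ∈ u, (p j * b j) * Real.exp (s * b j)) s := by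
  refine HasDerivAt.fun_sum fun j _ => ?_
  have h : HasDerivAt (fun s => p j * Real.exp (s * b j)) _ s :=
    (((hasDerivAt_id' s).mul_const (b j)).exp).const_mul (p j)
  exact h.congr_deriv (by ring)

/-- Differentiate the exponential identity at `s = 0`; the right side acquires the mean of
`centeredForm`, which is zero. -/
theorem sum_multinomialWeight_mul_linear {d : ℕ} (m : ℕ) {x : Fin d → ℝ} (hx : x ∈ unitSimplex d)
    (a : Fin d → ℝ) :
    ∑ k ∈ latticeSimplex d m, multinomialWeight m k x * ∑ i, a i * ((k i : ℝ) - m * x i) = 0 := by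
  have e := hasDerivAt_sum_mul_exp (latticeSimplex d m) (fun k => multinomialWeight m k x)
    (fun k => ∑ i, a i * ((k i : ℝ) - m * x i)) 0
  simp only [sum_multinomialWeight_mul_exp] at e
  have := e.unique ((hasDerivAt_sum_mul_exp Finset.univ (categoricalWeight x)
    (centeredForm a x) 0).fun_pow m)
  simpa [sum_categoricalWeight_mul_centeredForm hx a] using this

theorem sum_multinomialWeight_mul_sq {d : ℕ} (m : ℕ) {x : Fin d → ℝ} (hx : x ∈ unitSimplex d)
    (a : Fin d → ℝ) :
    ∑ k ∈ latticeSimplex d m, multinomialWeight m k x * (∑ i, a i * ((k i : ℝ) - m * x i)) ^ 2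
      = m * (∑ i, a i ^ 2 * x i - (∑ i, a i * x i) ^ 2) := by
  set w : (Fin d → ℕ) → ℝ := fun k => multinomialWeight m k x
  set z : (Fin d → ℕ) → ℝ := fun k => ∑ i, a i * ((k i : ℝ) - m * x i)
  set p := categoricalWeight x
  set b := centeredForm a x
  have h0 : (fun s => ∑ k ∈ latticeSimplex d m, w k * Real.exp (s * z k))
      = fun s => (∑ o, p o * Real.exp (s * b o)) ^ m :=
    funext fun s => sum_multinomialWeight_mul_exp m x a s
  -- The first derivative is needed for every `s`, so that it can be differentiated once more at 0.
  -- There the term from the derivative of the power contains the zero mean and drops out.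
  have h1 : (fun s => ∑ k ∈ latticeSimplex d m, (w k * z k) * Real.exp (s * z k))
      = fun s => (m * (∑ o, p o * Real.exp (s * b o)) ^ (m - 1))
          * ∑ o, (p o * b o) * Real.exp (s * b o) := by
    funext s
    have e := hasDerivAt_sum_mul_exp (latticeSimplex d m) w z s
    rw [h0] at e
    exact e.unique ((hasDerivAt_sum_mul_exp Finset.univ p b s).fun_pow m)
  have e := hasDerivAt_sum_mul_exp (latticeSimplex d m) (fun k => w k * z k) z 0
  simp only [h1] at e
  have e2 := ((((hasDerivAt_sum_mul_exp Finset.univ p b 0).fun_pow (m - 1)).const_mul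
    (m : ℝ)).fun_mul (hasDerivAt_sum_mul_exp Finset.univ (fun o => p o * b o) b 0))
  have := e.unique e2
  have hp1 : ∑ o, p o = 1 := sum_categoricalWeight hx
  have hp2 : ∑ o, p o * b o = 0 := sum_categoricalWeight_mul_centeredForm hx a
  simp only [zero_mul, Real.exp_zero, mul_one, hp1, hp2, one_pow, mul_zero, zero_add] at this
  rw [← sum_categoricalWeight_mul_centeredForm_sq hx a]
  simpa only [sq, mul_assoc] using this

/-- Exponential moments at `s = ±1/√m` are at most `e`, and `u ^ 4 ≤ 4! (exp u + exp (-u))` converts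
them into a fourth moment of order `m ^ 2`; the constant is `24 · 2e`. -/
theorem sum_multinomialWeight_mul_pow_four_le {d : ℕ} {m : ℕ} (hm : 0 < m) {x : Fin d → ℝ}
    (hx : x ∈ unitSimplex d) (i : Fin d) :
    ∑ k ∈ latticeSimplex d m, multinomialWeight m k x * ((k i : ℝ) - m * x i) ^ 4
      ≤ 48 * Real.exp 1 * (m : ℝ) ^ 2 := by
  have hm1 : (1 : ℝ) ≤ m := by exact_mod_cast hm
  have hsum : ∀ y : Fin d → ℝ, ∑ j, (Pi.single i 1 : Fin d → ℝ) j * y j = y i := fun y => by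
    simp [Pi.single_apply]
  have hb : ∀ o, |centeredForm (Pi.single i 1) x o| ≤ 1 := by
    intro o
    have h := hx.1 i
    rw [centeredForm, hsum]
    cases o with
    | none => simp only [Option.elim, abs_le]; constructor <;> linarith [h.1, h.2]
    | some j =>
      by_cases hj : j = i
      · subst hj; simp only [Option.elim, abs_le, Pi.single_eq_same]
        constructor <;> linarith [h.1, h.2]
      · simp only [Option.elim, abs_le, Pi.single_eq_of_ne hj]
        constructor <;> linarith [h.1, h.2]
  have key : ∀ s : ℝ, s ^ 2 = (m : ℝ)⁻¹ →
      ∑ k ∈ latticeSimplex d m, multinomialWeight m k x * Real.exp (s * ((k i : ℝ) - m * x i))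
        ≤ Real.exp 1 := by
    intro s hs
    have h := sum_multinomialWeight_mul_exp m x (Pi.single i 1) s
    simp only [hsum] at h
    rw [h]
    have hs1 : |s| ≤ 1 := by
      rw [← sq_le_one_iff_abs_le_one, hs]; exact inv_le_one_of_one_le₀ hm1
    -- Uses `exp v ≤ 1 + v + v ^ 2` for `|v| ≤ 1`; the linear term averages to zero.
    have hle : ∑ o, categoricalWeight x o * Real.exp (s * centeredForm (Pi.single i 1) x o)
        ≤ Real.exp (s ^ 2) := by
      calc _ ≤ ∑ o, categoricalWeight x o * (1 + s * centeredForm (Pi.single i 1) x o + s ^ 2) := by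
            refine Finset.sum_le_sum fun o _ =>
              mul_le_mul_of_nonneg_left ?_ (categoricalWeight_nonneg hx o)
            have hu : |s * centeredForm (Pi.single i 1) x o| ≤ 1 := by
              rw [abs_mul]; exact mul_le_one₀ hs1 (abs_nonneg _) (hb o)
            have h2 : (s * centeredForm (Pi.single i 1) x o) ^ 2 ≤ s ^ 2 := by
              rw [mul_pow]
              exact mul_le_of_le_one_right (sq_nonneg s) ((sq_le_one_iff_abs_le_one _).2 (hb o))
            linarith [(abs_le.1 (Real.abs_exp_sub_one_sub_id_le hu)).2]
        _ = 1 + s * ∑ o, categoricalWeight x o * centeredForm (Pi.single i 1) x o + s ^ 2 := by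
            simp only [mul_add, Finset.sum_add_distrib, ← Finset.sum_mul, sum_categoricalWeight hx,
              Finset.mul_sum, mul_one, one_mul]
            congr 2
            exact Finset.sum_congr rfl fun o _ => by ring
        _ ≤ Real.exp (s ^ 2) := by
            rw [sum_categoricalWeight_mul_centeredForm hx]
            linarith [Real.add_one_le_exp (s ^ 2)]
    calc _ ≤ Real.exp (s ^ 2) ^ m := by
          refine pow_le_pow_left₀ (Finset.sum_nonneg fun o _ => ?_) hle m
          exact mul_nonneg (categoricalWeight_nonneg hx o) (Real.exp_pos _).le
      _ = Real.exp 1 := by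
          rw [← Real.exp_nat_mul, hs, mul_inv_cancel₀ (by positivity)]
  set s : ℝ := (Real.sqrt m)⁻¹ with hs
  have hs2 : s ^ 2 = (m : ℝ)⁻¹ := by rw [hs, inv_pow, Real.sq_sqrt (by positivity)]
  have hpt : ∀ u : ℝ, u ^ 4 ≤ 24 * (Real.exp u + Real.exp (-u)) := by
    intro u
    have h := Real.pow_div_factorial_le_exp |u| (abs_nonneg u) 4
    have h4 : |u| ^ 4 = u ^ 4 := by rw [← abs_pow]; exact abs_of_nonneg (by positivity)
    have h5 : Real.exp |u| ≤ Real.exp u + Real.exp (-u) := Real.exp_abs_le u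
    rw [h4] at h
    norm_num [Nat.factorial] at h
    linarith
  have hk : ∀ k : Fin d → ℕ, multinomialWeight m k x * ((k i : ℝ) - m * x i) ^ 4
      ≤ 24 * (m : ℝ) ^ 2 * (multinomialWeight m k x * Real.exp (s * ((k i : ℝ) - m * x i))
        + multinomialWeight m k x * Real.exp (-s * ((k i : ℝ) - m * x i))) := by
    intro k
    have h := hpt (s * ((k i : ℝ) - m * x i))
    have h4 : (m : ℝ) ^ 2 * (s * ((k i : ℝ) - m * x i)) ^ 4 = ((k i : ℝ) - m * x i) ^ 4 := by
      rw [mul_pow, show s ^ 4 = (s ^ 2) ^ 2 by ring, hs2]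
      field_simp
    rw [← h4, neg_mul]
    have := mul_le_mul_of_nonneg_left h
      (mul_nonneg (multinomialWeight_nonneg (m := m) hx k) (sq_nonneg (m : ℝ)))
    linarith
  calc _ ≤ _ := Finset.sum_le_sum fun k _ => hk k
    _ ≤ 24 * (m : ℝ) ^ 2 * (Real.exp 1 + Real.exp 1) := by
        rw [← Finset.mul_sum, Finset.sum_add_distrib]
        gcongr
        · exact key s hs2
        · exact key (-s) (by rw [neg_sq, hs2])
    _ = _ := by ring

/-- Polarisation of the variance formula, with `a = e_i + e_j`. -/
theorem sum_multinomialWeight_mul_mul {d : ℕ} (m : ℕ) {x : Fin d → ℝ} (hx : x ∈ unitSimplex d)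
    (i j : Fin d) :
    ∑ k ∈ latticeSimplex d m,
        multinomialWeight m k x * (((k i : ℝ) - m * x i) * ((k j : ℝ) - m * x j))
      = m * ((if i = j then x i else 0) - x i * x j) := by
  have hsum : ∀ (l : Fin d) (y : Fin d → ℝ), ∑ i, (Pi.single l 1 : Fin d → ℝ) i * y i = y l :=
    fun l y => by simp [Pi.single_apply]
  have hsq : ∀ (l : Fin d) (y : Fin d → ℝ),
      ∑ i, (Pi.single l 1 : Fin d → ℝ) i ^ 2 * y i = y l := fun l y => by
    simp [Pi.single_apply]
  have hadd : ∑ l, (Pi.single i 1 + Pi.single j 1 : Fin d → ℝ) l ^ 2 * x l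
      = x i + x j + 2 * if i = j then x i else 0 := by
    simp only [Pi.add_apply, add_sq, add_mul, Finset.sum_add_distrib, hsq, mul_assoc,
      ← Finset.mul_sum, hsum]
    simp only [Pi.single_apply]
    split_ifs with h
    · subst h; ring
    · ring
  have h1 := sum_multinomialWeight_mul_sq m hx (Pi.single i 1)
  have h2 := sum_multinomialWeight_mul_sq m hx (Pi.single j 1)
  have h3 := sum_multinomialWeight_mul_sq m hx (Pi.single i 1 + Pi.single j 1)
  rw [hadd] at h3
  simp only [Pi.add_apply, add_mul, Finset.sum_add_distrib, hsum, hsq] at h1 h2 h3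
  have h4 : ∀ k : Fin d → ℕ,
      multinomialWeight m k x * (((k i : ℝ) - m * x i) * ((k j : ℝ) - m * x j))
      = (1 / 2) * (multinomialWeight m k x * (((k i : ℝ) - m * x i) + ((k j : ℝ) - m * x j)) ^ 2
        - multinomialWeight m k x * ((k i : ℝ) - m * x i) ^ 2
        - multinomialWeight m k x * ((k j : ℝ) - m * x j) ^ 2) := fun k => by ring
  simp only [h4, ← Finset.mul_sum, Finset.sum_sub_distrib, h1, h2, h3]
  ring

/-! ### The Bernstein operator on the simplex -/

section Bernstein

variable {d : ℕ} {m : ℕ}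

theorem div_mem_unitSimplex (hm : 0 < m) {k : Fin d → ℕ} (hk : k ∈ latticeSimplex d m) :
    (fun i => (k i : ℝ) / (m : ℝ)) ∈ unitSimplex d := by
  rw [mem_latticeSimplex] at hk
  have hm' : (0 : ℝ) < m := by exact_mod_cast hm
  refine ⟨fun i => ⟨by positivity, ?_⟩, ?_⟩
  · rw [div_le_one hm']
    exact_mod_cast (Finset.single_le_sum (fun j _ => Nat.zero_le (k j)) (Finset.mem_univ i)).trans hk
  · have : ∀ i, |(k i : ℝ) / (m : ℝ)| = (k i : ℝ) / m := fun i => abs_of_nonneg (by positivity)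
    simp only [l1Norm, this, ← Finset.sum_div]
    rw [div_le_one hm']
    exact_mod_cast hk

theorem bernsteinPoly_mono {x : Fin d → ℝ} (hx : x ∈ unitSimplex d) (hm : 0 < m)
    {f g : (Fin d → ℝ) → ℝ} (h : ∀ y ∈ unitSimplex d, f y ≤ g y) :
    bernsteinPoly m f x ≤ bernsteinPoly m g x :=
  Finset.sum_le_sum fun k hk =>
    mul_le_mul_of_nonneg_right (h _ (div_mem_unitSimplex hm hk)) (multinomialWeight_nonneg hx k)

theorem bernsteinPoly_add (f g : (Fin d → ℝ) → ℝ) (x : Fin d → ℝ) :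
    bernsteinPoly m (fun y => f y + g y) x = bernsteinPoly m f x + bernsteinPoly m g x := by
  simp only [bernsteinPoly, add_mul, Finset.sum_add_distrib]

theorem bernsteinPoly_sub (f g : (Fin d → ℝ) → ℝ) (x : Fin d → ℝ) :
    bernsteinPoly m (fun y => f y - g y) x = bernsteinPoly m f x - bernsteinPoly m g x := by
  simp only [bernsteinPoly, sub_mul, Finset.sum_sub_distrib]

theorem bernsteinPoly_const_mul (c : ℝ) (f : (Fin d → ℝ) → ℝ) (x : Fin d → ℝ) :
    bernsteinPoly m (fun y => c * f y) x = c * bernsteinPoly m f x := by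
  simp only [bernsteinPoly, mul_assoc, Finset.mul_sum]

theorem bernsteinPoly_sum {ι : Type*} (s : Finset ι) (f : ι → (Fin d → ℝ) → ℝ) (x : Fin d → ℝ) :
    bernsteinPoly m (fun y => ∑ i ∈ s, f i y) x = ∑ i ∈ s, bernsteinPoly m (f i) x := by
  simp only [bernsteinPoly, Finset.sum_mul]
  exact Finset.sum_comm

theorem bernsteinPoly_const {x : Fin d → ℝ} (hx : x ∈ unitSimplex d) (c : ℝ) :
    bernsteinPoly m (fun _ => c) x = c := by
  rw [bernsteinPoly, ← Finset.mul_sum, sum_multinomialWeight m hx, mul_one]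

theorem abs_bernsteinPoly_le {x : Fin d → ℝ} (hx : x ∈ unitSimplex d) (hm : 0 < m)
    {f g : (Fin d → ℝ) → ℝ} (h : ∀ y ∈ unitSimplex d, |f y| ≤ g y) :
    |bernsteinPoly m f x| ≤ bernsteinPoly m g x := by
  have h2 := bernsteinPoly_mono hx hm (f := fun y => (-1) * g y) (g := f)
    fun y hy => by linarith [(abs_le.1 (h y hy)).1]
  rw [bernsteinPoly_const_mul] at h2
  refine abs_le.2 ⟨by linarith, bernsteinPoly_mono hx hm fun y hy => (abs_le.1 (h y hy)).2⟩

theorem bernsteinPoly_sub_apply {x : Fin d → ℝ} (hx : x ∈ unitSimplex d) (hm : 0 < m)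
    (i : Fin d) : bernsteinPoly m (fun y => y i - x i) x = 0 := by
  have hm' : (m : ℝ) ≠ 0 := by positivity
  have h := sum_multinomialWeight_mul_linear m hx (Pi.single i 1)
  simp only [Pi.single_apply, ite_mul, one_mul, zero_mul, Finset.sum_ite_eq', Finset.mem_univ,
    if_true] at h
  rw [← mul_right_inj' hm', mul_zero, ← h, bernsteinPoly, Finset.mul_sum]
  refine Finset.sum_congr rfl fun k _ => ?_
  field_simp

theorem bernsteinPoly_mul_sub_apply {x : Fin d → ℝ} (hx : x ∈ unitSimplex d) (hm : 0 < m)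
    (i j : Fin d) : bernsteinPoly m (fun y => (y i - x i) * (y j - x j)) x
      = ((if i = j then x i else 0) - x i * x j) / m := by
  have hm' : (m : ℝ) ≠ 0 := by positivity
  have h := sum_multinomialWeight_mul_mul m hx i j
  rw [eq_div_iff hm', ← mul_right_inj' hm', ← h, bernsteinPoly, Finset.sum_mul, Finset.mul_sum]
  refine Finset.sum_congr rfl fun k _ => ?_
  field_simp

theorem bernsteinPoly_sum_sq_le {x : Fin d → ℝ} (hx : x ∈ unitSimplex d) (hm : 0 < m) :
    bernsteinPoly m (fun y => ∑ i, (y i - x i) ^ 2) x ≤ 1 / m := by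
  simp only [bernsteinPoly_sum, sq, bernsteinPoly_mul_sub_apply hx hm, if_true, ← Finset.sum_div]
  gcongr
  calc _ ≤ ∑ i, x i := Finset.sum_le_sum fun i _ => by linarith [mul_self_nonneg (x i)]
    _ ≤ 1 := l1Norm_eq_sum hx ▸ hx.2

theorem bernsteinPoly_sum_pow_four_le {x : Fin d → ℝ} (hx : x ∈ unitSimplex d) (hm : 0 < m) :
    bernsteinPoly m (fun y => ∑ i, (y i - x i) ^ 4) x ≤ d * (48 * Real.exp 1) / (m : ℝ) ^ 2 := by
  have hm' : (0 : ℝ) < m := by exact_mod_cast hm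
  rw [bernsteinPoly_sum]
  have : ∀ i : Fin d, bernsteinPoly m (fun y => (y i - x i) ^ 4) x
      ≤ 48 * Real.exp 1 / (m : ℝ) ^ 2 := by
    intro i
    have h := sum_multinomialWeight_mul_pow_four_le hm hx i
    have e : bernsteinPoly m (fun y => (y i - x i) ^ 4) x
        = (∑ k ∈ latticeSimplex d m, multinomialWeight m k x * ((k i : ℝ) - m * x i) ^ 4)
          / (m : ℝ) ^ 4 := by
      rw [bernsteinPoly, Finset.sum_div]
      refine Finset.sum_congr rfl fun k _ => ?_
      field_simp
    rw [e, div_le_div_iff₀ (by positivity) (by positivity)]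
    calc _ ≤ (48 * Real.exp 1 * (m : ℝ) ^ 2) * (m : ℝ) ^ 2 := by gcongr
      _ = _ := by ring
  calc _ ≤ ∑ _i : Fin d, 48 * Real.exp 1 / (m : ℝ) ^ 2 := Finset.sum_le_sum fun i _ => this i
    _ = _ := by simp; ring

theorem norm_sq_le_sum_sq (z : Fin d → ℝ) : ‖z‖ ^ 2 ≤ ∑ i, z i ^ 2 := by
  have h0 : 0 ≤ ∑ i, z i ^ 2 := Finset.sum_nonneg fun i _ => sq_nonneg _
  rw [← Real.le_sqrt (norm_nonneg _) h0, pi_norm_le_iff_of_nonneg (Real.sqrt_nonneg _)]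
  intro i
  rw [Real.norm_eq_abs]
  exact Real.abs_le_sqrt
    (Finset.single_le_sum (f := fun i => z i ^ 2) (fun j _ => sq_nonneg (z j)) (Finset.mem_univ i))

/-- Apply the quadratic bound to the vector of squares. -/
theorem norm_pow_four_le_sum_pow_four (z : Fin d → ℝ) : ‖z‖ ^ 4 ≤ ∑ i, z i ^ 4 := by
  have h := norm_sq_le_sum_sq fun i => z i ^ 2
  have h2 : ‖z‖ ^ 2 ≤ ‖fun i => z i ^ 2‖ := by
    rw [← Real.le_sqrt (norm_nonneg _) (norm_nonneg _),
      pi_norm_le_iff_of_nonneg (Real.sqrt_nonneg _)]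
    intro i
    rw [Real.norm_eq_abs]
    refine Real.abs_le_sqrt ?_
    have := norm_le_pi_norm (fun i => z i ^ 2) i
    rwa [Real.norm_of_nonneg (sq_nonneg _)] at this
  calc ‖z‖ ^ 4 = (‖z‖ ^ 2) ^ 2 := by ring
    _ ≤ ‖fun i => z i ^ 2‖ ^ 2 := by gcongr
    _ ≤ _ := h
    _ = _ := by simp only [← pow_mul]

/-- Bernstein's argument: `g` is small within `δ` of `x`, and farther away `|g| ≤ M ≤ (M / δ ^ 2) ‖y
- x‖ ^ 2`, whose smoothing at `x` is `O(1/m)`. -/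
theorem tendsto_bernsteinPoly_zero {x : Fin d → ℝ} (hx : x ∈ unitSimplex d)
    {g : (Fin d → ℝ) → ℝ} {M : ℝ} (hM : ∀ y ∈ unitSimplex d, |g y| ≤ M)
    (hg : ContinuousWithinAt g (unitSimplex d) x) (hgx : g x = 0) :
    Tendsto (fun m => bernsteinPoly m g x) atTop (𝓝 0) := by
  have hM0 : 0 ≤ M := (abs_nonneg _).trans (hM x hx)
  rw [Metric.tendsto_atTop]
  intro ε hε
  obtain ⟨δ, hδ, hδg⟩ := Metric.continuousWithinAt_iff.1 hg (ε / 2) (by positivity)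
  have hlim : Tendsto (fun m : ℕ => ε / 2 + M / δ ^ 2 * (1 / (m : ℝ))) atTop (𝓝 (ε / 2)) := by
    simpa using (tendsto_one_div_atTop_nhds_zero_nat (𝕜 := ℝ)).const_mul (M / δ ^ 2)
      |>.const_add (ε / 2)
  obtain ⟨N, hN⟩ := eventually_atTop.1
    ((hlim.eventually_lt_const (by linarith : ε / 2 < ε)).and (eventually_gt_atTop 0))
  refine ⟨N, fun m hm => ?_⟩
  obtain ⟨h1, hm0⟩ := hN m hm
  rw [dist_zero_right, Real.norm_eq_abs]
  refine lt_of_le_of_lt ?_ h1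
  calc _ ≤ bernsteinPoly m (fun y => ε / 2 + M / δ ^ 2 * ∑ i, (y i - x i) ^ 2) x := by
        refine abs_bernsteinPoly_le hx hm0 fun y hy => ?_
        have hs := norm_sq_le_sum_sq (y - x)
        simp only [Pi.sub_apply] at hs
        by_cases hyd : dist y x < δ
        · have := hδg hy hyd
          rw [hgx, dist_zero_right, Real.norm_eq_abs] at this
          have : 0 ≤ M / δ ^ 2 * ∑ i, (y i - x i) ^ 2 :=
            mul_nonneg (by positivity) (Finset.sum_nonneg fun i _ => sq_nonneg _)
          linarith
        · rw [dist_eq_norm, not_lt] at hyd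
          have : M / δ ^ 2 * δ ^ 2 ≤ M / δ ^ 2 * ∑ i, (y i - x i) ^ 2 := by
            gcongr
            exact (pow_le_pow_left₀ hδ.le hyd 2).trans hs
          rw [div_mul_cancel₀ _ (by positivity)] at this
          linarith [hM y hy]
    _ ≤ _ := by
        rw [bernsteinPoly_add, bernsteinPoly_const hx, bernsteinPoly_const_mul]
        gcongr
        exact bernsteinPoly_sum_sq_le hx hm0

/-- Near `x`, the bound `(ε / 2) ‖y - x‖ ^ 2` contributes at most `ε / 2` after multiplication by
`m`. Away from `x` a second-moment bound would only give `O(1)`, so the fourth moment, of order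
`m⁻²`, is used. -/
theorem tendsto_mul_bernsteinPoly_zero {x : Fin d → ℝ} (hx : x ∈ unitSimplex d)
    {g : (Fin d → ℝ) → ℝ} {M : ℝ} (hM : ∀ y ∈ unitSimplex d, |g y| ≤ M)
    (hg : g =o[𝓝 x] fun y => ‖y - x‖ ^ 2) :
    Tendsto (fun m : ℕ => (m : ℝ) * bernsteinPoly m g x) atTop (𝓝 0) := by
  have hM0 : 0 ≤ M := (abs_nonneg _).trans (hM x hx)
  rw [Metric.tendsto_atTop]
  intro ε hε
  obtain ⟨δ, hδ, hδg⟩ := Metric.eventually_nhds_iff.1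
    (Asymptotics.isLittleO_iff.1 hg (c := ε / 2) (by positivity))
  set C : ℝ := M / δ ^ 4 * (d * (48 * Real.exp 1)) with hC
  have hlim : Tendsto (fun m : ℕ => ε / 2 + C * (1 / (m : ℝ))) atTop (𝓝 (ε / 2)) := by
    simpa using (tendsto_one_div_atTop_nhds_zero_nat (𝕜 := ℝ)).const_mul C |>.const_add (ε / 2)
  obtain ⟨N, hN⟩ := eventually_atTop.1
    ((hlim.eventually_lt_const (by linarith : ε / 2 < ε)).and (eventually_gt_atTop 0))
  refine ⟨N, fun m hm => ?_⟩
  obtain ⟨h1, hm0⟩ := hN m hm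
  have hm' : (0 : ℝ) < m := by exact_mod_cast hm0
  rw [dist_zero_right, Real.norm_eq_abs, abs_mul, abs_of_pos hm']
  refine lt_of_le_of_lt ?_ h1
  calc _ ≤ (m : ℝ) * bernsteinPoly m (fun y => ε / 2 * ∑ i, (y i - x i) ^ 2
        + M / δ ^ 4 * ∑ i, (y i - x i) ^ 4) x := by
        gcongr
        refine abs_bernsteinPoly_le hx hm0 fun y hy => ?_
        have hs := norm_sq_le_sum_sq (y - x)
        have hs4 := norm_pow_four_le_sum_pow_four (y - x)
        simp only [Pi.sub_apply] at hs hs4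
        have p2 : 0 ≤ ε / 2 * ∑ i, (y i - x i) ^ 2 :=
          mul_nonneg (by positivity) (Finset.sum_nonneg fun i _ => sq_nonneg _)
        have p4 : 0 ≤ M / δ ^ 4 * ∑ i, (y i - x i) ^ 4 :=
          mul_nonneg (by positivity) (Finset.sum_nonneg fun i _ => by positivity)
        by_cases hyd : dist y x < δ
        · have := hδg hyd
          rw [Real.norm_eq_abs, Real.norm_of_nonneg (sq_nonneg _)] at this
          have : ε / 2 * ‖y - x‖ ^ 2 ≤ ε / 2 * ∑ i, (y i - x i) ^ 2 := by gcongr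
          linarith
        · rw [dist_eq_norm, not_lt] at hyd
          have : M / δ ^ 4 * δ ^ 4 ≤ M / δ ^ 4 * ∑ i, (y i - x i) ^ 4 := by
            gcongr
            exact (pow_le_pow_left₀ hδ.le hyd 4).trans hs4
          rw [div_mul_cancel₀ _ (by positivity)] at this
          linarith [hM y hy]
    _ ≤ (m : ℝ) * (ε / 2 * (1 / m) + M / δ ^ 4 * (d * (48 * Real.exp 1) / (m : ℝ) ^ 2)) := by
        rw [bernsteinPoly_add, bernsteinPoly_const_mul, bernsteinPoly_const_mul]
        gcongr
        · exact bernsteinPoly_sum_sq_le hx hm0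
        · exact bernsteinPoly_sum_pow_four_le hx hm0
    _ = _ := by rw [hC]; field_simp

end Bernstein

/-! ### Taylor expansion and Voronovskaya's theorem -/

/-- The remainder has derivative `F'(z) - F'(x) - H (z - x)`, which is `o(‖z - x‖)` because `F'` is
differentiable at `x`. The mean value inequality on the segment from `x` to `y` supplies the second
factor `‖y - x‖`. -/
theorem ContDiffAt.taylor_two_isLittleO {E : Type*} [NormedAddCommGroup E] [NormedSpace ℝ E]
    {F : E → ℝ} {x : E} (hF : ContDiffAt ℝ 2 F x) :
    (fun y => F y - F x - fderiv ℝ F x (y - x)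
      - 1 / 2 * fderiv ℝ (fderiv ℝ F) x (y - x) (y - x)) =o[𝓝 x] fun y => ‖y - x‖ ^ 2 := by
  set H := fderiv ℝ (fderiv ℝ F) x with hH
  have hsymm : ∀ u v, H u v = H v u := (hF.isSymmSndFDerivAt (by simp)).eq
  have hd : ∀ᶠ y in 𝓝 x, DifferentiableAt ℝ F y := by
    have := hF.eventually (by simp)
    filter_upwards [this] with y hy using hy.differentiableAt (by simp)
  have hd2 : HasFDerivAt (fderiv ℝ F) H x :=
    ((hF.fderiv_right (m := 1) (by norm_num)).differentiableAt (by simp)).hasFDerivAt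
  rw [Asymptotics.isLittleO_iff]
  intro c hc
  have hc' := Asymptotics.isLittleO_iff.1 hd2.isLittleO hc
  obtain ⟨δ, hδ, hball⟩ := Metric.eventually_nhds_iff_ball.1 (hd.and hc')
  filter_upwards [Metric.ball_mem_nhds x hδ] with y hy
  set r := ‖y - x‖
  have hseg : segment ℝ x y ⊆ Metric.ball x δ :=
    (convex_ball x δ).segment_subset (Metric.mem_ball_self hδ) hy
  set φ : E → ℝ := fun z => F z - F x - fderiv ℝ F x (z - x) - 1 / 2 * H (z - x) (z - x)
  have hφ : ∀ z ∈ segment ℝ x y, HasFDerivWithinAt φ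
      (fderiv ℝ F z - fderiv ℝ F x - H (z - x)) (segment ℝ x y) z := by
    intro z hz
    have hz' := (hball z (hseg hz)).1.hasFDerivAt
    have hs : HasFDerivAt (fun z : E => z - x) (ContinuousLinearMap.id ℝ E) z :=
      (hasFDerivAt_id z).sub_const x
    have h1 : HasFDerivAt (fun z => fderiv ℝ F x (z - x)) (fderiv ℝ F x) z :=
      (fderiv ℝ F x).hasFDerivAt.comp z hs
    have h2 := (H.hasFDerivAt.comp z hs).clm_apply hs
    have h3 := ((hz'.sub_const (F x)).sub h1).sub (h2.const_mul (1 / 2 : ℝ))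
    refine (h3.congr_fderiv ?_).hasFDerivWithinAt
    ext v
    -- Symmetry of `H` merges the two halves of the derivative of the quadratic form, cancelling the
    -- `1/2`.
    simp [hsymm v z, hsymm v x]
    ring
  have hb : ∀ z ∈ segment ℝ x y, ‖fderiv ℝ F z - fderiv ℝ F x - H (z - x)‖ ≤ c * r := by
    intro z hz
    refine (hball z (hseg hz)).2.trans ?_
    gcongr
    obtain ⟨t, ht, rfl⟩ := segment_eq_image_lineMap ℝ x y ▸ hz
    rw [AffineMap.lineMap_apply, vsub_eq_sub, vadd_eq_add, add_sub_cancel_right, norm_smul,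
      Real.norm_of_nonneg ht.1]
    exact mul_le_of_le_one_left (norm_nonneg _) ht.2
  have := (convex_segment x y).norm_image_sub_le_of_norm_hasFDerivWithin_le hφ hb
    (left_mem_segment ℝ x y) (right_mem_segment ℝ x y)
  have hφx : φ x = 0 := by simp [φ]
  rw [hφx, sub_zero] at this
  rw [Real.norm_of_nonneg (sq_nonneg r)]
  calc _ ≤ _ := this
    _ = _ := by ring

theorem unitSimplexInt_subset (d : ℕ) : unitSimplexInt d ⊆ unitSimplex d :=
  fun _ hx => ⟨fun i => Set.Ioo_subset_Icc_self (hx.1 i), hx.2.le⟩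

theorem isOpen_unitSimplexInt (d : ℕ) : IsOpen (unitSimplexInt d) := by
  have : unitSimplexInt d = (⋂ i, {x | x i ∈ Set.Ioo (0 : ℝ) 1}) ∩ {x | l1Norm x < 1} := by
    ext x; simp [unitSimplexInt]
  rw [this]
  refine IsOpen.inter (isOpen_iInter_of_finite fun i => isOpen_Ioo.preimage (continuous_apply i)) ?_
  exact isOpen_lt (by unfold l1Norm; fun_prop) continuous_const

theorem unitSimplex_mem_nhds {d : ℕ} {x : Fin d → ℝ} (hx : x ∈ unitSimplexInt d) :
    unitSimplex d ∈ 𝓝 x :=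
  mem_of_superset ((isOpen_unitSimplexInt d).mem_nhds hx) (unitSimplexInt_subset d)

theorem partialDerivSimplex_partialDerivSimplex {d : ℕ} {F : (Fin d → ℝ) → ℝ} {x : Fin d → ℝ}
    (hx : x ∈ unitSimplexInt d) (hF : ContDiffAt ℝ 2 F x) (i j : Fin d) :
    partialDerivSimplex i (partialDerivSimplex j F) x
      = fderiv ℝ (fderiv ℝ F) x (Pi.single i 1) (Pi.single j 1) := by
  -- The outer derivative needs the inner one on a whole neighbourhood, where the within-derivative
  -- is the ordinary one because the interior is open.
  have he : partialDerivSimplex j F =ᶠ[𝓝 x] fun y => fderiv ℝ F y (Pi.single j 1) := by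
    filter_upwards [(isOpen_unitSimplexInt d).mem_nhds hx] with y hy
    rw [partialDerivSimplex, fderivWithin_of_mem_nhds (unitSimplex_mem_nhds hy)]
  have hd2 : DifferentiableAt ℝ (fderiv ℝ F) x :=
    (hF.fderiv_right (m := 1) (by norm_num)).differentiableAt (by simp)
  rw [partialDerivSimplex, fderivWithin_of_mem_nhds (unitSimplex_mem_nhds hx), he.fderiv_eq,
    fderiv_clm_apply hd2 (by fun_prop)]
  simp

theorem norm_sub_le_one_of_mem_unitSimplex {d : ℕ} {x y : Fin d → ℝ} (hx : x ∈ unitSimplex d)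
    (hy : y ∈ unitSimplex d) : ‖y - x‖ ≤ 1 := by
  rw [pi_norm_le_iff_of_nonneg zero_le_one]
  intro i
  rw [Pi.sub_apply, Real.norm_eq_abs, abs_le]
  constructor <;> linarith [(hx.1 i).1, (hx.1 i).2, (hy.1 i).1, (hy.1 i).2]

/-- Voronovskaya's theorem for Bernstein polynomials on the simplex. -/
theorem tendsto_mul_bernsteinPoly_sub {d : ℕ} {F : (Fin d → ℝ) → ℝ} {x : Fin d → ℝ}
    (hx : x ∈ unitSimplexInt d) (hF : ContDiffAt ℝ 2 F x) {M : ℝ}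
    (hM : ∀ y ∈ unitSimplex d, |F y| ≤ M) :
    Tendsto (fun m : ℕ => (m : ℝ) * (bernsteinPoly m F x - F x)) atTop (𝓝 (biasCoeff F x)) := by
  have hxS := unitSimplexInt_subset d hx
  set L := fderiv ℝ F x
  set H := fderiv ℝ (fderiv ℝ F) x
  set R : (Fin d → ℝ) → ℝ := fun y => F y - F x - L (y - x) - 1 / 2 * H (y - x) (y - x) with hR
  have hbound : ∀ y ∈ unitSimplex d, |R y| ≤ M + M + ‖L‖ + 1 / 2 * ‖H‖ := by
    intro y hy
    have hn := norm_sub_le_one_of_mem_unitSimplex hxS hy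
    have h1 : |L (y - x)| ≤ ‖L‖ := L.unit_le_opNorm _ hn
    have h2 : |H (y - x) (y - x)| ≤ ‖H‖ :=
      ((H (y - x)).unit_le_opNorm _ hn).trans (H.unit_le_opNorm _ hn)
    have h3 := hM y hy
    have h4 := hM x hxS
    rw [abs_le] at h1 h2 h3 h4 ⊢
    constructor <;> simp only [hR] <;> linarith [h1.1, h1.2, h2.1, h2.2, h3.1, h3.2, h4.1, h4.2]
  -- Only the remainder `R` is asymptotic: smoothing kills the linear term (`hLB`), and the
  -- quadratic term times `m` is exactly `biasCoeff F x` (`hHB`).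
  have hlim := (tendsto_mul_bernsteinPoly_zero hxS hbound hF.taylor_two_isLittleO).add_const
    (biasCoeff F x)
  rw [zero_add] at hlim
  refine hlim.congr' ?_
  filter_upwards [eventually_gt_atTop 0] with m hm
  have hm' : (m : ℝ) ≠ 0 := by positivity
  have hz : ∀ z : Fin d → ℝ, z = ∑ i, z i • (Pi.single i 1 : Fin d → ℝ) := fun z => by
    conv_lhs => rw [← Finset.univ_sum_single z]
    exact Finset.sum_congr rfl fun i _ => by rw [← Pi.single_smul, smul_eq_mul, mul_one]
  have hLe : ∀ y : Fin d → ℝ, L (y - x) = ∑ i, L (Pi.single i 1) * (y i - x i) := fun y => by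
    conv_lhs => rw [hz (y - x)]
    simp [map_sum, mul_comm]
  have hHe : ∀ y : Fin d → ℝ, H (y - x) (y - x)
      = ∑ i, ∑ j, H (Pi.single i 1) (Pi.single j 1) * ((y i - x i) * (y j - x j)) := fun y => by
    conv_lhs => rw [hz (y - x)]
    simp only [map_sum, map_smul, sum_apply, smul_apply,
      smul_eq_mul, Pi.sub_apply, Finset.mul_sum]
    rw [Finset.sum_comm]
    exact Finset.sum_congr rfl fun i _ => Finset.sum_congr rfl fun j _ => by ring
  have hLB : bernsteinPoly m (fun y => L (y - x)) x = 0 := by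
    simp only [hLe, bernsteinPoly_sum, bernsteinPoly_const_mul, bernsteinPoly_sub_apply hxS hm,
      mul_zero, Finset.sum_const_zero]
  have hHB : (m : ℝ) * (1 / 2 * bernsteinPoly m (fun y => H (y - x) (y - x)) x)
      = biasCoeff F x := by
    simp only [hHe, bernsteinPoly_sum, bernsteinPoly_const_mul,
      bernsteinPoly_mul_sub_apply hxS hm, biasCoeff,
      partialDerivSimplex_partialDerivSimplex hx hF]
    rw [mul_left_comm]
    congr 1
    simp only [Finset.mul_sum]
    refine Finset.sum_congr rfl fun i _ => Finset.sum_congr rfl fun j _ => ?_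
    simp only [H]
    field_simp
  rw [hR, bernsteinPoly_sub, bernsteinPoly_sub, bernsteinPoly_sub, bernsteinPoly_const hxS,
    bernsteinPoly_const_mul, hLB, ← hHB]
  ring

/-! ### The estimator as an average of kernels, and the kernel's variance -/

/-- The Bernstein smoothing, evaluated at `x`, of the empirical c.d.f. of the single point `u`. -/
noncomputable def bernsteinKernel {d : ℕ} (m : ℕ) (x u : Fin d → ℝ) : ℝ :=
  bernsteinPoly m (fun y => (Set.Iic y).indicator (fun _ => (1 : ℝ)) u) x

/-- The `ν`-measure of the symmetric difference of the lower sets of `x` and `y`. -/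
noncomputable def cdfSymmDiff {d : ℕ} (ν : Measure (Fin d → ℝ)) (x y : Fin d → ℝ) : ℝ :=
  jointCDF ν x + jointCDF ν y - 2 * jointCDF ν (x ⊓ y)

section Kernel

variable {d : ℕ} {m : ℕ}

theorem bernsteinEstimator_eq (n : ℕ) (s : ℕ → Fin d → ℝ) (x : Fin d → ℝ) :
    bernsteinEstimator n m s x = (n : ℝ)⁻¹ * ∑ i ∈ Finset.range n, bernsteinKernel m x (s i) := by
  unfold bernsteinEstimator bernsteinKernel empiricalCDF
  rw [bernsteinPoly_const_mul, bernsteinPoly_sum]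

theorem measurable_bernsteinKernel (x : Fin d → ℝ) : Measurable (bernsteinKernel m x) := by
  unfold bernsteinKernel bernsteinPoly
  exact Finset.measurable_fun_sum _ fun k _ =>
    (measurable_const.indicator measurableSet_Iic).mul_const _

theorem indicator_one_nonneg {α : Type*} (s : Set α) (u : α) :
    0 ≤ s.indicator (fun _ => (1 : ℝ)) u :=
  Set.indicator_nonneg (fun _ _ => zero_le_one) u

theorem indicator_one_le_one {α : Type*} (s : Set α) (u : α) :
    s.indicator (fun _ => (1 : ℝ)) u ≤ 1 :=
  Set.indicator_le_self' (fun _ _ => zero_le_one) u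

theorem bernsteinKernel_nonneg {x : Fin d → ℝ} (hx : x ∈ unitSimplex d) (u : Fin d → ℝ) :
    0 ≤ bernsteinKernel m x u :=
  Finset.sum_nonneg fun k _ =>
    mul_nonneg (indicator_one_nonneg _ _) (multinomialWeight_nonneg hx k)

theorem bernsteinKernel_le_one {x : Fin d → ℝ} (hx : x ∈ unitSimplex d) (u : Fin d → ℝ) :
    bernsteinKernel m x u ≤ 1 := by
  rw [← sum_multinomialWeight m hx]
  exact Finset.sum_le_sum fun k _ =>
    mul_le_of_le_one_left (multinomialWeight_nonneg hx k) (indicator_one_le_one _ _)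

theorem abs_bernsteinKernel_sub_le_one {x : Fin d → ℝ} (hx : x ∈ unitSimplex d)
    (u : Fin d → ℝ) :
    |bernsteinKernel m x u - (Set.Iic x).indicator (fun _ => (1 : ℝ)) u| ≤ 1 := by
  rw [abs_le]
  constructor <;> linarith [bernsteinKernel_nonneg (m := m) hx u,
    bernsteinKernel_le_one (m := m) hx u, indicator_one_nonneg (Set.Iic x) u,
    indicator_one_le_one (Set.Iic x) u]

theorem memLp_of_abs_le_one {α : Type*} [MeasurableSpace α] {μ : Measure α} [IsFiniteMeasure μ]
    {f : α → ℝ} (hf : Measurable f) (h : ∀ u, |f u| ≤ 1) (p : ENNReal) : MemLp f p μ :=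
  MemLp.of_bound hf.aestronglyMeasurable 1 (ae_of_all _ h)

theorem abs_indicator_one_le_one {α : Type*} (s : Set α) (u : α) :
    |s.indicator (fun _ => (1 : ℝ)) u| ≤ 1 := by
  rw [abs_of_nonneg (indicator_one_nonneg s u)]
  exact indicator_one_le_one s u

theorem measurable_indicator_Iic (x : Fin d → ℝ) :
    Measurable ((Set.Iic x).indicator fun _ => (1 : ℝ)) :=
  measurable_const.indicator measurableSet_Iic

/-- Both sides are the indicator of the symmetric difference, as `Iic x ∩ Iic y = Iic (x ⊓ y)`. -/
theorem abs_indicator_Iic_sub (x y u : Fin d → ℝ) :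
    |(Set.Iic y).indicator (fun _ => (1 : ℝ)) u - (Set.Iic x).indicator (fun _ => (1 : ℝ)) u|
      = (Set.Iic x).indicator (fun _ => (1 : ℝ)) u + (Set.Iic y).indicator (fun _ => (1 : ℝ)) u
        - 2 * (Set.Iic (x ⊓ y)).indicator (fun _ => (1 : ℝ)) u := by
  by_cases h1 : u ≤ x <;> by_cases h2 : u ≤ y <;> simp [Set.indicator, h1, h2]
  norm_num

variable (ν : Measure (Fin d → ℝ))

theorem integral_indicator_Iic (x : Fin d → ℝ) :
    ∫ u, (Set.Iic x).indicator (fun _ => (1 : ℝ)) u ∂ν = jointCDF ν x := by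
  rw [integral_indicator measurableSet_Iic]
  simp [jointCDF]

theorem integral_bernsteinPoly (m : ℕ) (x : Fin d → ℝ) (f : (Fin d → ℝ) → (Fin d → ℝ) → ℝ)
    (hf : ∀ y, Integrable (f y) ν) :
    ∫ u, bernsteinPoly m (fun y => f y u) x ∂ν = bernsteinPoly m (fun y => ∫ u, f y u ∂ν) x := by
  unfold bernsteinPoly
  rw [integral_finsetSum _ fun k _ => (hf _).mul_const _]
  simp only [integral_mul_const]

variable [IsProbabilityMeasure ν]

theorem integrable_indicator_Iic (x : Fin d → ℝ) :
    Integrable ((Set.Iic x).indicator fun _ => (1 : ℝ)) ν :=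
  memLp_one_iff_integrable.1
    (memLp_of_abs_le_one (measurable_indicator_Iic x) (abs_indicator_one_le_one _) 1)

theorem abs_jointCDF_le_one (x : Fin d → ℝ) : |jointCDF ν x| ≤ 1 := by
  rw [jointCDF, abs_of_nonneg measureReal_nonneg]
  exact measureReal_le_one

theorem integral_bernsteinKernel (x : Fin d → ℝ) :
    ∫ u, bernsteinKernel m x u ∂ν = bernsteinPoly m (jointCDF ν) x := by
  unfold bernsteinKernel
  rw [integral_bernsteinPoly ν m x (fun y => (Set.Iic y).indicator fun _ => (1 : ℝ))
    (integrable_indicator_Iic ν)]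
  simp only [integral_indicator_Iic]

/-- The difference `f` has `|f| ≤ 1`, so `Var f ≤ E f ^ 2 ≤ E|f|`. The weights sum to 1, so `|f|` is
at most the weighted average of `|1_{u ≤ y} - 1_{u ≤ x}|` over the nodes `y`; exchanging integral
and finite sum gives the bound. -/
theorem variance_bernsteinKernel_sub_le {x : Fin d → ℝ} (hx : x ∈ unitSimplex d) (hm : 0 < m) :
    Var[fun u => bernsteinKernel m x u - (Set.Iic x).indicator (fun _ => (1 : ℝ)) u; ν]
      ≤ bernsteinPoly m (cdfSymmDiff ν x) x := by
  set f : (Fin d → ℝ) → (Fin d → ℝ) → ℝ := fun y u =>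
    (Set.Iic x).indicator (fun _ => (1 : ℝ)) u + (Set.Iic y).indicator (fun _ => (1 : ℝ)) u
        - 2 * (Set.Iic (x ⊓ y)).indicator (fun _ => (1 : ℝ)) u with hf
  have hfi : ∀ y, Integrable (f y) ν := fun y =>
    ((integrable_indicator_Iic ν x).add (integrable_indicator_Iic ν y)).sub
      ((integrable_indicator_Iic ν _).const_mul 2)
  have hmeas := (measurable_bernsteinKernel (m := m) x).sub (measurable_indicator_Iic x)
  have hint : ∀ y, ∫ u, f y u ∂ν = cdfSymmDiff ν x y := fun y => by
    have h := integral_sub ((integrable_indicator_Iic ν x).add (integrable_indicator_Iic ν y))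
      ((integrable_indicator_Iic ν (x ⊓ y)).const_mul 2)
    simp only [Pi.add_apply] at h
    rw [integral_add (integrable_indicator_Iic ν x) (integrable_indicator_Iic ν y),
      integral_const_mul] at h
    simp only [integral_indicator_Iic] at h
    exact h
  have hb : ∀ u, |bernsteinKernel m x u - (Set.Iic x).indicator (fun _ => (1 : ℝ)) u|
      ≤ bernsteinPoly m (fun y => f y u) x := fun u => by
    have h := bernsteinPoly_sub (m := m) (fun y => (Set.Iic y).indicator (fun _ => (1 : ℝ)) u)
      (fun _ => (Set.Iic x).indicator (fun _ => (1 : ℝ)) u) x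
    rw [bernsteinPoly_const hx] at h
    rw [bernsteinKernel, ← h]
    exact abs_bernsteinPoly_le hx hm fun y _ => (abs_indicator_Iic_sub x y u).le
  refine (variance_le_expectation_sq hmeas.aestronglyMeasurable).trans ?_
  calc _ ≤ ∫ u, bernsteinPoly m (fun y => f y u) x ∂ν := by
        refine integral_mono ?_ ?_ fun u => ?_
        · exact (memLp_of_abs_le_one hmeas (abs_bernsteinKernel_sub_le_one hx) 2).integrable_sq
        · unfold bernsteinPoly
          exact integrable_finsetSum _ fun k _ => (hfi _).mul_const _
        · refine le_trans ?_ (hb u)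
          have h1 := abs_bernsteinKernel_sub_le_one (m := m) hx u
          simp only [Pi.pow_apply]
          rw [← sq_abs, sq]
          exact mul_le_of_le_one_left (abs_nonneg _) h1
    _ = _ := by
        rw [integral_bernsteinPoly ν m x f hfi]
        simp only [hint]

theorem tendsto_bernsteinPoly_cdfSymmDiff {x : Fin d → ℝ} (hx : x ∈ unitSimplex d)
    (hF : ContinuousAt (jointCDF ν) x) :
    Tendsto (fun m => bernsteinPoly m (cdfSymmDiff ν x) x) atTop (𝓝 0) := by
  refine tendsto_bernsteinPoly_zero hx (M := 4) (fun y _ => ?_) ?_ ?_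
  · have h1 := abs_le.1 (abs_jointCDF_le_one ν x)
    have h2 := abs_le.1 (abs_jointCDF_le_one ν y)
    have h3 := abs_le.1 (abs_jointCDF_le_one ν (x ⊓ y))
    rw [cdfSymmDiff, abs_le]
    constructor <;> linarith [h1.1, h1.2, h2.1, h2.2, h3.1, h3.2]
  · refine ContinuousAt.continuousWithinAt ?_
    have h : ContinuousAt (fun y => jointCDF ν (x ⊓ y)) x := by
      refine ContinuousAt.comp (g := jointCDF ν) (f := fun y => x ⊓ y) ?_
        (continuous_pi fun i => continuous_const.inf (continuous_apply i)).continuousAt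
      simpa using hF
    exact (continuousAt_const.add hF).sub (h.const_mul 2)
  · simp [cdfSymmDiff]; ring

end Kernel

/-! ### Limit theorems -/

section Limit

variable {d : ℕ} {Ω : Type*} [MeasurableSpace Ω] {P : Measure Ω} {ν : Measure (Fin d → ℝ)}
  {X : ℕ → Ω → (Fin d → ℝ)}

theorem variance_comp_of_hasLaw {Y : Ω → Fin d → ℝ} (hY : HasLaw Y ν P) {f : (Fin d → ℝ) → ℝ}
    (hf : Measurable f) : Var[fun ω => f (Y ω); P] = Var[f; ν] := by
  rw [← hY.map_eq, variance_map hf.aemeasurable hY.aemeasurable]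
  rfl

theorem integral_comp_of_hasLaw {Y : Ω → Fin d → ℝ} (hY : HasLaw Y ν P) {f : (Fin d → ℝ) → ℝ}
    (hf : Measurable f) : ∫ ω, f (Y ω) ∂P = ∫ u, f u ∂ν :=
  hY.integral_comp hf.aestronglyMeasurable

variable [IsProbabilityMeasure P]

theorem memLp_comp_of_hasLaw {Y : Ω → Fin d → ℝ} (hY : HasLaw Y ν P) {f : (Fin d → ℝ) → ℝ}
    (hf : Measurable f) (h : ∀ u, |f u| ≤ 1) (p : ENNReal) : MemLp (fun ω => f (Y ω)) p P :=
  MemLp.of_bound (hf.comp_aemeasurable hY.aemeasurable).aestronglyMeasurable 1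
    (ae_of_all _ fun ω => h (Y ω))

theorem measureReal_abs_normalized_sum_ge_le (hlaw : ∀ i, HasLaw (X i) ν P)
    (hindep : iIndepFun X P) {f : (Fin d → ℝ) → ℝ} (hf : Measurable f) (hf1 : ∀ u, |f u| ≤ 1)
    (n : ℕ) {ε : ℝ} (hε : 0 < ε) :
    P.real {ω | ε ≤ |(Real.sqrt n)⁻¹ * (∑ i ∈ Finset.range n, f (X i ω) - n * ∫ u, f u ∂ν)|}
      ≤ Var[f; ν] / ε ^ 2 := by
  have hL : ∀ i, MemLp (fun ω => f (X i ω)) 2 P := fun i => memLp_comp_of_hasLaw (hlaw i) hf hf1 2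
  set S : Ω → ℝ := ∑ i ∈ Finset.range n, fun ω => f (X i ω) with hSdef
  have hS : MemLp S 2 P := memLp_finsetSum' _ fun i _ => hL i
  have hvar : Var[S; P] = n * Var[f; ν] := by
    rw [hSdef, IndepFun.variance_sum (fun i _ => hL i) fun i _ j _ hij =>
      (hindep.indepFun hij).comp hf hf]
    simp [variance_comp_of_hasLaw (hlaw _) hf]
  have hmean : ∫ ω, S ω ∂P = n * ∫ u, f u ∂ν := by
    simp only [hSdef, Finset.sum_apply]
    rw [integral_finsetSum _ fun i _ => (hL i).integrable one_le_two]
    simp [integral_comp_of_hasLaw (hlaw _) hf]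
  have h := meas_ge_le_variance_div_sq (hS.const_mul (Real.sqrt n)⁻¹) hε
  rw [integral_const_mul, variance_const_mul, hmean, hvar] at h
  simp only [← mul_sub, hSdef, Finset.sum_apply] at h
  have h0 : 0 ≤ Var[f; ν] := variance_nonneg _ _
  refine (ENNReal.toReal_le_of_le_ofReal (by positivity) h).trans ?_
  gcongr
  rw [inv_pow, Real.sq_sqrt (Nat.cast_nonneg n), ← mul_assoc]
  -- An inequality rather than an equality because `n⁻¹ * n = 0` at `n = 0`.
  exact mul_le_of_le_one_left h0 inv_mul_le_one

variable [IsProbabilityMeasure ν]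

theorem variance_indicator_Iic (x : Fin d → ℝ) :
    Var[(Set.Iic x).indicator (fun _ => (1 : ℝ)); ν] = sigmaSq (jointCDF ν) x := by
  rw [variance_eq_sub
    (memLp_of_abs_le_one (measurable_indicator_Iic x) (abs_indicator_one_le_one _) 2),
    integral_indicator_Iic]
  have : (Set.Iic x).indicator (fun _ => (1 : ℝ)) ^ 2 = (Set.Iic x).indicator fun _ => (1 : ℝ) := by
    ext u
    by_cases h : u ∈ Set.Iic x <;> simp [h]
  rw [this, integral_indicator_Iic, sigmaSq]
  ring

theorem tendstoInDistribution_empirical (hlaw : ∀ i, HasLaw (X i) ν P) (hindep : iIndepFun X P)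
    (x : Fin d → ℝ) :
    TendstoInDistribution (fun (n : ℕ) ω => (Real.sqrt n)⁻¹ *
        (∑ i ∈ Finset.range n, (Set.Iic x).indicator (fun _ => (1 : ℝ)) (X i ω)
          - n * jointCDF ν x))
      atTop (id : ℝ → ℝ) (fun _ => P) (gaussianReal 0 (sigmaSq (jointCDF ν) x).toNNReal) := by
  have hm := measurable_indicator_Iic x
  have hident : ∀ i, IdentDistrib (fun ω => (Set.Iic x).indicator (fun _ => (1 : ℝ)) (X i ω))
      (fun ω => (Set.Iic x).indicator (fun _ => (1 : ℝ)) (X 0 ω)) P P := fun i =>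
    IdentDistrib.comp ⟨(hlaw i).aemeasurable, (hlaw 0).aemeasurable,
      (hlaw i).map_eq.trans (hlaw 0).map_eq.symm⟩ hm
  have hv : Var[fun ω => (Set.Iic x).indicator (fun _ => (1 : ℝ)) (X 0 ω); P]
      = sigmaSq (jointCDF ν) x := by
    rw [variance_comp_of_hasLaw (hlaw 0) hm, variance_indicator_Iic]
  have h := tendstoInDistribution_inv_sqrt_mul_sum_sub (P := P)
    (P' := gaussianReal 0 (sigmaSq (jointCDF ν) x).toNNReal) (Y := id)
    (X := fun i ω => (Set.Iic x).indicator (fun _ => (1 : ℝ)) (X i ω))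
    (by rw [hv]; exact HasLaw.id)
    (memLp_comp_of_hasLaw (hlaw 0) hm (abs_indicator_one_le_one _) 2)
    (hindep.comp (fun _ => (Set.Iic x).indicator fun _ => (1 : ℝ)) fun _ => hm) hident
  rwa [integral_comp_of_hasLaw (hlaw 0) hm, integral_indicator_Iic] at h

/-- Slutsky: the gap to the normalised empirical c.d.f. is a normalised sum of kernel minus
indicator. Its Chebyshev bound depends on `n` only through `m n`, hence no growth rate is required.
-/
theorem tendstoInDistribution_bernsteinEstimator (hlaw : ∀ i, HasLaw (X i) ν P)
    (hindep : iIndepFun X P) {x : Fin d → ℝ} (hx : x ∈ unitSimplex d)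
    (hF : ContinuousAt (jointCDF ν) x) {m : ℕ → ℕ} (hm : Tendsto m atTop atTop) :
    TendstoInDistribution
      (fun (n : ℕ) (ω : Ω) => Real.sqrt (n : ℝ) *
        (bernsteinEstimator n (m n) (fun i => X i ω) x - bernsteinPoly (m n) (jointCDF ν) x))
      atTop (id : ℝ → ℝ) (fun _ => P) (gaussianReal 0 (sigmaSq (jointCDF ν) x).toNNReal) := by
  have hker : ∀ n i, AEMeasurable (fun ω => bernsteinKernel (m n) x (X i ω)) P := fun n i =>
    (measurable_bernsteinKernel x).comp_aemeasurable (hlaw i).aemeasurable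
  refine tendstoInDistribution_of_tendstoInMeasure_sub _ _
    (tendstoInDistribution_empirical hlaw hindep x) ?_ fun n => ?_
  · rw [tendstoInMeasure_iff_measureReal_norm]
    intro ε hε
    have hlim := ((tendsto_bernsteinPoly_cdfSymmDiff ν hx hF).comp hm).div_const (ε ^ 2)
    rw [zero_div] at hlim
    refine tendsto_of_tendsto_of_tendsto_of_le_of_le' tendsto_const_nhds hlim
      (Eventually.of_forall fun _ => measureReal_nonneg) ?_
    filter_upwards [hm.eventually_gt_atTop 0] with n hmn
    set f : (Fin d → ℝ) → ℝ := fun u =>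
      bernsteinKernel (m n) x u - (Set.Iic x).indicator (fun _ => (1 : ℝ)) u with hfdef
    have hf : Measurable f := (measurable_bernsteinKernel x).sub (measurable_indicator_Iic x)
    have h := measureReal_abs_normalized_sum_ge_le hlaw hindep hf
      (abs_bernsteinKernel_sub_le_one hx) n hε
    have hint : ∫ u, f u ∂ν = bernsteinPoly (m n) (jointCDF ν) x - jointCDF ν x := by
      rw [integral_sub _ (integrable_indicator_Iic ν x), integral_bernsteinKernel,
        integral_indicator_Iic]
      refine memLp_one_iff_integrable.1 (memLp_of_abs_le_one (measurable_bernsteinKernel x) ?_ 1)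
      intro u
      rw [abs_of_nonneg (bernsteinKernel_nonneg hx u)]
      exact bernsteinKernel_le_one hx u
    have hrw : ∀ ω, (Real.sqrt n)⁻¹ * (∑ i ∈ Finset.range n, f (X i ω) - n * ∫ u, f u ∂ν)
        = Real.sqrt n * (bernsteinEstimator n (m n) (fun i => X i ω) x
            - bernsteinPoly (m n) (jointCDF ν) x)
          - (Real.sqrt n)⁻¹ *
            (∑ i ∈ Finset.range n, (Set.Iic x).indicator (fun _ => (1 : ℝ)) (X i ω)
              - n * jointCDF ν x) := by
      intro ω
      rw [hint, bernsteinEstimator_eq, hfdef, Finset.sum_sub_distrib]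
      rcases Nat.eq_zero_or_pos n with rfl | hn
      · simp
      · have hn' : (0 : ℝ) < n := by exact_mod_cast hn
        have hs : Real.sqrt n ≠ 0 := (Real.sqrt_pos.2 hn').ne'
        have hsq : Real.sqrt n ^ 2 = n := Real.sq_sqrt hn'.le
        field_simp
        rw [hsq]
        ring
    simp only [hrw] at h
    simp only [Pi.sub_apply, Pi.zero_apply, sub_zero, Real.norm_eq_abs]
    refine h.trans ?_
    simp only [Function.comp]
    gcongr
    exact variance_bernsteinKernel_sub_le ν hx hmn
  · simp only [bernsteinEstimator_eq]
    exact (((Finset.aemeasurable_fun_sum _ fun i _ => hker n i).const_mul _).sub_const _).const_mul _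

/-- Adds the deterministic bias by Slutsky. The sign of `lam` is left free so that `lam = 0` covers
the regime of negligible bias. -/
theorem tendstoInDistribution_bernsteinEstimator_sub_cdf (hlaw : ∀ i, HasLaw (X i) ν P)
    (hindep : iIndepFun X P) {x : Fin d → ℝ} (hx : x ∈ unitSimplexInt d)
    (hF : ContDiffAt ℝ 2 (jointCDF ν) x) {m : ℕ → ℕ} (hm : Tendsto m atTop atTop) {lam : ℝ}
    (hlam : Tendsto (fun n : ℕ => Real.sqrt (n : ℝ) / (m n : ℝ)) atTop (𝓝 lam)) :
    TendstoInDistribution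
      (fun (n : ℕ) (ω : Ω) => Real.sqrt (n : ℝ) *
        (bernsteinEstimator n (m n) (fun i => X i ω) x - jointCDF ν x))
      atTop (id : ℝ → ℝ) (fun _ => P)
      (gaussianReal (lam * biasCoeff (jointCDF ν) x) (sigmaSq (jointCDF ν) x).toNNReal) := by
  have hbias : Tendsto (fun n : ℕ => Real.sqrt n *
      (bernsteinPoly (m n) (jointCDF ν) x - jointCDF ν x)) atTop
      (𝓝 (lam * biasCoeff (jointCDF ν) x)) := by
    have h := hlam.mul ((tendsto_mul_bernsteinPoly_sub hx hF
      fun y _ => abs_jointCDF_le_one ν y).comp hm)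
    refine h.congr' ?_
    filter_upwards [hm.eventually_gt_atTop 0] with n hmn
    have : (m n : ℝ) ≠ 0 := by positivity
    simp only [Function.comp]
    field_simp
  have h1 := tendstoInDistribution_bernsteinEstimator hlaw hindep (unitSimplexInt_subset d hx)
    hF.continuousAt hm
  have h2 : TendstoInMeasure P (fun (n : ℕ) (_ : Ω) => Real.sqrt n *
      (bernsteinPoly (m n) (jointCDF ν) x - jointCDF ν x)) atTop
      (fun _ => lam * biasCoeff (jointCDF ν) x) :=
    tendstoInMeasure_of_tendsto_ae (fun _ => aestronglyMeasurable_const) (ae_of_all _ fun _ => hbias)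
  have h3 := h1.add_of_tendstoInMeasure_const h2 fun _ => aemeasurable_const
  have h4 : (fun n : ℕ => (fun ω => Real.sqrt n * (bernsteinEstimator n (m n) (fun i => X i ω) x
        - bernsteinPoly (m n) (jointCDF ν) x)) + fun _ => Real.sqrt n *
        (bernsteinPoly (m n) (jointCDF ν) x - jointCDF ν x))
      = fun (n : ℕ) (ω : Ω) => Real.sqrt (n : ℝ) *
        (bernsteinEstimator n (m n) (fun i => X i ω) x - jointCDF ν x) := by
    funext n ω
    simp only [Pi.add_apply]
    ring
  rw [h4] at h3
  refine ⟨h3.forall_aemeasurable, aemeasurable_id, ?_⟩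
  -- The limit variable is `id` plus a constant, whose law is the Gaussian translated by that
  -- constant.
  convert h3.tendsto using 3
  refine congrArg 𝓝 (Subtype.ext ?_)
  simp only [id]
  rw [gaussianReal_map_add_const, zero_add]
  exact Measure.map_id

end Limit

theorem mainTheorem7 {d : ℕ} {Ω : Type*} [MeasurableSpace Ω]
    (P : Measure Ω) [IsProbabilityMeasure P]
    (ν : Measure (Fin d → ℝ)) [IsProbabilityMeasure ν]
    (X : ℕ → Ω → (Fin d → ℝ))
    (hlaw : ∀ i, HasLaw (X i) ν P) (hindep : iIndepFun X P)
    (hF : ContDiffOn ℝ 2 (jointCDF ν) (unitSimplex d))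
    (x : Fin d → ℝ) (hx : x ∈ unitSimplexInt d)
    (hx0 : 0 < jointCDF ν x) (hx1 : jointCDF ν x < 1) :
    (∀ m : ℕ → ℕ, Tendsto m atTop atTop →
      TendstoInDistribution
        (fun (n : ℕ) (ω : Ω) => Real.sqrt (n : ℝ) *
          (bernsteinEstimator n (m n) (fun i => X i ω) x - bernsteinPoly (m n) (jointCDF ν) x))
        atTop (id : ℝ → ℝ) (fun _ => P)
        (gaussianReal 0 (sigmaSq (jointCDF ν) x).toNNReal)) ∧
    (∀ m : ℕ → ℕ, Tendsto m atTop atTop →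
      Tendsto (fun n : ℕ => Real.sqrt (n : ℝ) / (m n : ℝ)) atTop (𝓝 0) →
      TendstoInDistribution
        (fun (n : ℕ) (ω : Ω) => Real.sqrt (n : ℝ) *
          (bernsteinEstimator n (m n) (fun i => X i ω) x - jointCDF ν x))
        atTop (id : ℝ → ℝ) (fun _ => P)
        (gaussianReal 0 (sigmaSq (jointCDF ν) x).toNNReal)) ∧
    (∀ (m : ℕ → ℕ) (lam : ℝ), Tendsto m atTop atTop → 0 < lam →
      Tendsto (fun n : ℕ => Real.sqrt (n : ℝ) / (m n : ℝ)) atTop (𝓝 lam) →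
      TendstoInDistribution
        (fun (n : ℕ) (ω : Ω) => Real.sqrt (n : ℝ) *
          (bernsteinEstimator n (m n) (fun i => X i ω) x - jointCDF ν x))
        atTop (id : ℝ → ℝ) (fun _ => P)
        (gaussianReal (lam * biasCoeff (jointCDF ν) x)
          (sigmaSq (jointCDF ν) x).toNNReal)) := by
  have hFx : ContDiffAt ℝ 2 (jointCDF ν) x := hF.contDiffAt (unitSimplex_mem_nhds hx)
  refine ⟨fun m hm => tendstoInDistribution_bernsteinEstimator hlaw hindep
    (unitSimplexInt_subset d hx) hFx.continuousAt hm, fun m hm h0 => ?_, fun m lam hm _ hlam =>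
    tendstoInDistribution_bernsteinEstimator_sub_cdf hlaw hindep hx hFx hm hlam⟩
  simpa only [zero_mul] using
    tendstoInDistribution_bernsteinEstimator_sub_cdf hlaw hindep hx hFx hm h0
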